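/- **Model.** A computational DAG $G=(V,E)$ is a finite directed acyclic graph; $\Delta_{in}$ is its largest in-degree. In multiprocessor red-blue pebbling with $k$ processors, fast memory size $r$ and I/O cost $g$ ($k,r,g\in\mathbb{Z}^+$), a configuration consists of sets $R^1,\dots,R^k\subseteq V$ (red pebbles of each processor) with $|R^j|\le r$, and a set $B\subseteq V$ (blue pebbles); initially all are empty. In one step, either a nonempty set of processors acts simultaneously, each on one node $v$ of its choice, all by the same one of the following three rules (for processor $j$): *save* (if $v\in R^j$, add $v$ to $B$), *load* (if $v\in B$, add $v$ to $R^j$), *compute* (if all in-neighbours of $v$ are in $R^j$, add $v$ to $R^j$); or a single pebble is removed. A save or load step costs $g$, a compute step costs $1$, a removal is free. A pebbling is a sequence of steps after which every sink has a pebble; $\mathrm{OPT}$ is the minimum total cost of a pebbling. **Greedy pebblings.** A node is *ready* if it has not been computed yet by any processor, but each of its in-neighbours has been computed by some processor. At the start, and right after each step in which next-goal nodes are computed, every processor is assigned a next-goal node: in some arbitrary order, each processor takes, among the ready nodes not yet taken, one with the largest number of in-neighbours that carry a red pebble of this processor at this moment (ties broken arbitrarily); a processor gets no goal only if no ready node is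 left. Alternatively, the largest fraction of such in-neighbours is used, where the fraction for a source is interpreted as $0$ or as $1$. Then all processors compute their next-goal nodes concurrently, in one step. Before and after this step the strategy is free to perform any saves, loads and removals, and any recomputations by a processor of nodes that this same processor computed before (a processor without a goal may also recompute such a node in the common step); no node is computed by a processor for the first time in any other way. A pebbling of this form is called greedy. **Lemma.** Let $k=2$. 1. For all integers $\Delta\ge 0$ and $g\ge 1$ there are an $r\ge\Delta+1$ and a sequence of DAGs $G_1,G_2,\dots$ with $|V(G_i)|\to\infty$ and $\Delta_{in}(G_i)=\Delta$ for all $i$, such that greedy pebblings are asymptotically worse than the optimum by a factor of at least $\frac15\Delta-1$. 2. For every integer $g\ge2$ there is a sequence of DAGs $G_1,G_2,\dots$ with $|V(G_i)|\to\infty$ such that, whenever the fast memory is unbounded (that is, for any sizes $r_i\ge|V(G_i)|$), greedy pebblings are asymptotically worse than the optimum by a factor of at least $\frac23 g+1$. Here "asymptotically worse by a factor of at least $c$" means: for every form of the greedy rule (number, or fraction with either convention for sources) and every $\varepsilon>0$, for all sufficiently large $i$, every greedy pebbling of $G_i$ has cost at least $(c-\varepsilon)\cdot\mathrm{OPT}(G_i)$.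 -/

import Mathlib

open Filter

/-- A computational DAG: a finite directed graph without directed cycles.
`graph.Adj u v` is the edge from `u` to `v`, so `u` is an in-neighbour of `v`. -/
structure CompDAG where
  V : Type
  finite : Finite V
  graph : Digraph V
  acyclic : ∀ v : V, ¬ Relation.TransGen graph.Adj v v

namespace CompDAG

/-- The number `n` of nodes. -/
noncomputable def size (G : CompDAG) : ℕ := Nat.card G.V

/-- The set of in-neighbours (predecessors) of `v`. -/
def preds (G : CompDAG) (v : G.V) : Set G.V := {u | G.graph.Adj u v}

noncomputable def inDegree (G : CompDAG) (v : G.V) : ℕ := (G.preds v).ncard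

/-- The largest in-degree of a node. -/
noncomputable def maxInDegree (G : CompDAG) : ℕ := ⨆ v : G.V, G.inDegree v

/-- Sinks: nodes without outgoing edges. -/
def sinks (G : CompDAG) : Set G.V := {v | ∀ w, ¬ G.graph.Adj v w}

end CompDAG

/-- A configuration: the red pebbles of each of the `k` processors, and the blue pebbles. -/
structure Config (V : Type) (k : ℕ) where
  red : Fin k → Set V
  blue : Set V

/-- A choice of at most one node for each processor; `none` means that the processor does not
take part. -/
abbrev Selection (V : Type) (k : ℕ) := Fin k → Option V

/-- The transition rules. In `save`, `load` and `compute` a nonempty set of processors acts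
simultaneously, each on one node. -/
inductive Move (V : Type) (k : ℕ) where
  | save (f : Selection V k)
  | load (f : Selection V k)
  | compute (f : Selection V k)
  | removeRed (p : Fin k) (v : V)
  | removeBlue (v : V)

namespace Config

/-- The initial configuration has no pebbles. -/
def init (V : Type) (k : ℕ) : Config V k := ⟨fun _ => ∅, ∅⟩

/-- Each processor holds at most `r` red pebbles. -/
def Valid {V : Type} {k : ℕ} (r : ℕ) (C : Config V k) : Prop :=
  ∀ p, (C.red p).ncard ≤ r

/-- Every sink has a pebble. -/
def Terminal {k : ℕ} (G : CompDAG) (C : Config G.V k) : Prop :=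
  ∀ v ∈ G.sinks, v ∈ C.blue ∨ ∃ p, v ∈ C.red p

end Config

namespace Move

/-- A move may be applied in the configuration `C`. -/
def Applicable {k : ℕ} (G : CompDAG) (C : Config G.V k) : Move G.V k → Prop
  | save f => (∃ p v, f p = some v) ∧ ∀ p v, f p = some v → v ∈ C.red p
  | load f => (∃ p v, f p = some v) ∧ ∀ p v, f p = some v → v ∈ C.blue
  | compute f => (∃ p v, f p = some v) ∧ ∀ p v, f p = some v → G.preds v ⊆ C.red p
  | removeRed p v => v ∈ C.red p
  | removeBlue v => v ∈ C.blue

/-- The configuration after a move. -/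
def apply {V : Type} {k : ℕ} (C : Config V k) : Move V k → Config V k
  | save f => ⟨C.red, C.blue ∪ {v | ∃ p, f p = some v}⟩
  | load f => ⟨fun p => C.red p ∪ {v | f p = some v}, C.blue⟩
  | compute f => ⟨fun p => C.red p ∪ {v | f p = some v}, C.blue⟩
  | removeRed p v => ⟨fun q => {w | w ∈ C.red q ∧ ¬ (q = p ∧ w = v)}, C.blue⟩
  | removeBlue v => ⟨C.red, C.blue \ {v}⟩

/-- An I/O move costs `g`, a compute move costs `1`, removing a pebble is free. -/
def cost {V : Type} {k : ℕ} (g : ℕ) : Move V k → ℕ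
  | save _ => g
  | load _ => g
  | compute _ => 1
  | removeRed _ _ => 0
  | removeBlue _ => 0

def IsCompute {V : Type} {k : ℕ} : Move V k → Prop
  | compute _ => True
  | _ => False

end Move

/-- The moves can be carried out one after the other from `C`, through valid configurations, and
end in a terminal configuration. -/
def PebblesFrom {k : ℕ} (G : CompDAG) (r : ℕ) : Config G.V k → List (Move G.V k) → Prop
  | C, [] => C.Terminal G
  | C, m :: ms => m.Applicable G C ∧ (m.apply C).Valid r ∧ PebblesFrom G r (m.apply C) ms

/-- A pebbling strategy with `k` processors of fast memory size `r`. -/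
def IsPebbling (G : CompDAG) (k r : ℕ) (P : List (Move G.V k)) : Prop :=
  PebblesFrom G r (Config.init G.V k) P

/-- The total cost of a sequence of moves. -/
def pebblingCost {V : Type} {k : ℕ} (g : ℕ) (P : List (Move V k)) : ℕ :=
  (P.map (Move.cost g)).sum

/-- The optimum: the minimum cost of a pebbling strategy. -/
noncomputable def pebblingOPT (G : CompDAG) (k r g : ℕ) : ℕ :=
  sInf {c | ∃ P : List (Move G.V k), IsPebbling G k r P ∧ pebblingCost g P = c}

/-- What a processor maximizes: the number of its red pebbles on the in-neighbours of a node, or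
the fraction of in-neighbours that have one. For the fraction, sources (whose ratio is `0 / 0`)
count as `1` or as `0`, as the flag says. -/
inductive GreedyRule where
  | count
  | fraction (sourcesAreOne : Bool)

open Classical in
/-- The score of the node `v` for the processor `p` in the configuration `C`. -/
noncomputable def GreedyRule.score {k : ℕ} (rule : GreedyRule) (G : CompDAG)
    (C : Config G.V k) (p : Fin k) (v : G.V) : ℚ :=
  match rule with
  | .count => ((G.preds v ∩ C.red p).ncard : ℚ)
  | .fraction b =>
      if G.inDegree v = 0 then (if b = true then 1 else 0)
      else ((G.preds v ∩ C.red p).ncard : ℚ) / (G.inDegree v : ℚ)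

/-- `hist p` is the set of nodes computed so far by the processor `p`. A node is ready if it has
not been computed by any processor, but each of its in-neighbours has. -/
def IsReady {k : ℕ} (G : CompDAG) (hist : Fin k → Set G.V) (v : G.V) : Prop :=
  (∀ p, v ∉ hist p) ∧ ∀ u ∈ G.preds v, ∃ p, u ∈ hist p

/-- `goal` is a greedy choice of next-goal nodes: in some order of the processors, each of them
takes a ready node of the highest score among those not yet taken (ties are broken arbitrarily),
and gets no goal only if every ready node is taken. The arbitrary order stands for the arbitrary
resolution of conflicts between processors that prefer the same node. -/
def IsGreedyChoice {k : ℕ} (rule : GreedyRule) (G : CompDAG) (C : Config G.V k)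
    (hist : Fin k → Set G.V) (goal : Selection G.V k) : Prop :=
  ∃ order : Equiv.Perm (Fin k), ∀ p,
    let avail : Set G.V :=
      {v | IsReady G hist v ∧ ∀ q, order q < order p → goal q ≠ some v}
    (goal p = none → avail = ∅) ∧
    ∀ v, goal p = some v → v ∈ avail ∧ ∀ w ∈ avail, rule.score G C p w ≤ rule.score G C p v

/-- `GreedyFrom rule G C hist goal P`: from the configuration `C`, with computation history `hist`
and current next-goal nodes `goal`, the moves `P` follow the greedy rule.
I/O moves and removals are free to choose, and so are recomputations by a processor of nodes that
it has computed before. A node is computed by a processor for the first time only in a move in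
which all processors compute their next-goal nodes concurrently (a processor without a goal may
idle or recompute); the new next-goal nodes are then chosen according to the configuration right
after this move. -/
inductive GreedyFrom {k : ℕ} (rule : GreedyRule) (G : CompDAG) :
    Config G.V k → (Fin k → Set G.V) → Selection G.V k → List (Move G.V k) → Prop
  | done (C : Config G.V k) (hist : Fin k → Set G.V) (goal : Selection G.V k) :
      GreedyFrom rule G C hist goal []
  | other (C : Config G.V k) (hist : Fin k → Set G.V) (goal : Selection G.V k)
      (m : Move G.V k) (P : List (Move G.V k)) (hm : ¬ m.IsCompute)
      (h : GreedyFrom rule G (m.apply C) hist goal P) :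
      GreedyFrom rule G C hist goal (m :: P)
  | recompute (C : Config G.V k) (hist : Fin k → Set G.V) (goal : Selection G.V k)
      (f : Selection G.V k) (P : List (Move G.V k))
      (hf : ∀ p v, f p = some v → v ∈ hist p)
      (h : GreedyFrom rule G ((Move.compute f).apply C) hist goal P) :
      GreedyFrom rule G C hist goal (Move.compute f :: P)
  | advance (C : Config G.V k) (hist : Fin k → Set G.V) (goal goal' : Selection G.V k)
      (f : Selection G.V k) (P : List (Move G.V k))
      (hgoal : ∀ p v, goal p = some v → f p = some v)
      (hidle : ∀ p, goal p = none → ∀ v, f p = some v → v ∈ hist p)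
      (hchoice : IsGreedyChoice rule G ((Move.compute f).apply C)
        (fun p => hist p ∪ {v | f p = some v}) goal')
      (h : GreedyFrom rule G ((Move.compute f).apply C)
        (fun p => hist p ∪ {v | f p = some v}) goal' P) :
      GreedyFrom rule G C hist goal (Move.compute f :: P)

/-- A pebbling strategy that follows the greedy rule from the start. -/
def IsGreedyPebbling (rule : GreedyRule) (G : CompDAG) (k r : ℕ)
    (P : List (Move G.V k)) : Prop :=
  IsPebbling G k r P ∧
    ∃ goal : Selection G.V k,
      IsGreedyChoice rule G (Config.init G.V k) (fun _ => ∅) goal ∧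
      GreedyFrom rule G (Config.init G.V k) (fun _ => ∅) goal P

/-- On the DAGs `G i`, with `k` processors of fast memory size `r i`, every greedy pebbling is
asymptotically (for `i → ∞`) worse than the optimum by a factor of at least `c`, for every form
of the greedy rule. -/
def GreedyWorseByFactor (k g : ℕ) (r : ℕ → ℕ) (G : ℕ → CompDAG) (c : ℝ) : Prop :=
  ∀ rule : GreedyRule, ∀ ε : ℝ, 0 < ε → ∀ᶠ i in atTop,
    ∀ P : List (Move (G i).V k), IsGreedyPebbling rule (G i) k (r i) P →
      (c - ε) * (pebblingOPT (G i) k (r i) g : ℝ) ≤ (pebblingCost g P : ℝ)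

/-! Both claims use a ladder: two paths whose nodes of equal index share their remaining
in-neighbours, all on the `false` path. Whenever two nodes of one index are ready, a processor
scores the continuation of its own path higher by exactly one red in-neighbour, so the processor
choosing first stays on its path and the other gets the remaining node (`score_lt_score`,
`Locked.advance`). Hence the processor on the `true` path never computes a `false` node, and every
shared in-neighbour must reach it through blue pebbles. `GreedyFrom.potential_bound` turns this into
a cost bound: the potential records the I/O already paid for and not yet used up.

Small memory: the shared in-neighbours alternate between two blocks of size `m = Δ - 1`, and `r = m
+ 2`. Computing a `true` node beyond the first indices fills the memory, so the other block is
absent afterwards and each stage costs `g * m + 1`. It is cheaper to keep one block in each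
processor and to pass the two paths back and forth, at cost `2 * g + 1` per stage
(`finishableWithin_alternatingBlocks`).

Unbounded memory: index `j` needs the `false` node of index `j - 2`. Greedy pays one save and one
load per such node, about `2 * g + 1` per index, while computing everything without communication
costs `2` per index (`opt_ladder_le`). -/

/-! ### Ladder graphs -/

/-- Two directed paths of length `n`. Moreover, the nodes with index `j` of both paths have as
in-neighbours the nodes of the `false` path with an index in `D j` (and below `j - 1`). -/
abbrev ladder (n : ℕ) (D : ℕ → Finset ℕ) : CompDAG where
  V := Bool × Fin n
  finite := inferInstance
  graph := ⟨fun u v => (u.1 = v.1 ∧ u.2.val + 1 = v.2.val) ∨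
    (u.1 = false ∧ u.2.val + 1 < v.2.val ∧ u.2.val ∈ D v.2.val)⟩
  acyclic := by
    intro v h
    have key : ∀ w, Relation.TransGen (fun u v : Bool × Fin n => (u.1 = v.1 ∧ u.2.val + 1 = v.2.val) ∨
        (u.1 = false ∧ u.2.val + 1 < v.2.val ∧ u.2.val ∈ D v.2.val)) v w →
        v.2.val < w.2.val := by
      intro w hw
      induction hw with
      | single h => rcases h with h | h <;> omega
      | tail _ h ih => rcases h with h | h <;> omega
    exact lt_irrefl _ (key v h)

variable {n : ℕ} {D : ℕ → Finset ℕ}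

theorem ladder_size : (ladder n D).size = 2 * n := by
  change Nat.card (Bool × Fin n) = 2 * n
  simp

/-- The in-neighbours on the `false` path that are common to both nodes of index `j`. -/
def rung (n : ℕ) (D : ℕ → Finset ℕ) (j : ℕ) : Set (Bool × Fin n) :=
  {u | u.1 = false ∧ u.2.val + 1 < j ∧ u.2.val ∈ D j}

theorem mem_ladder_preds {u v : Bool × Fin n} :
    u ∈ (ladder n D).preds v ↔
      (u.1 = v.1 ∧ u.2.val + 1 = v.2.val) ∨ u ∈ rung n D v.2.val := Iff.rfl

theorem ladder_preds_zero (b : Bool) (h : 0 < n) :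
    (ladder n D).preds ((b, ⟨0, h⟩) : Bool × Fin n) = ∅ := by
  ext u
  rw [mem_ladder_preds]
  simp [rung]

theorem ladder_preds_succ (b : Bool) {i : ℕ} (h : i + 1 < n) :
    (ladder n D).preds ((b, ⟨i + 1, h⟩) : Bool × Fin n) =
      insert (b, ⟨i, by omega⟩) (rung n D (i + 1)) := by
  ext ⟨c, j⟩
  rw [mem_ladder_preds]
  simp [Prod.ext_iff, Fin.ext_iff]

theorem lt_of_mem_ladder_preds {u v : Bool × Fin n} (h : u ∈ (ladder n D).preds v) :
    u.2.val < v.2.val := by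
  rcases h with h | h <;> omega

theorem not_mem_rung_succ (b : Bool) {i : ℕ} (h : i < n) :
    ((b, ⟨i, h⟩) : Bool × Fin n) ∉ rung n D (i + 1) := by
  simp [rung]

/-- Distinct indices give distinct nodes on a single path. -/
theorem ncard_row {F : Finset ℕ} (hF : ∀ j ∈ F, j < n) :
    {u : Bool × Fin n | u.1 = false ∧ u.2.val ∈ F}.ncard = F.card := by
  have h1 : (fun u : Bool × Fin n => u.2.val) '' {u | u.1 = false ∧ u.2.val ∈ F} = (F : Set ℕ) := by
    ext j
    constructor
    · rintro ⟨u, hu, rfl⟩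
      exact hu.2
    · intro hj
      exact ⟨(false, ⟨j, hF j hj⟩), ⟨rfl, hj⟩, rfl⟩
  rw [← Set.ncard_coe_finset, ← h1, Set.InjOn.ncard_image]
  rintro ⟨a, i⟩ ⟨h, -⟩ ⟨b, j⟩ ⟨h', -⟩ hij
  simp_all [Fin.ext_iff]

/-! ### The forced course of a greedy strategy -/

/-- The processor `q` has computed the nodes with index below `i` of its own path, and its
next-goal node is the next one of that path. -/
structure Locked (D : ℕ → Finset ℕ) (side : Fin 2 → Bool) (i : ℕ)
    (C : Config (Bool × Fin n) 2) (hist : Fin 2 → Set (Bool × Fin n))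
    (goal : Selection (Bool × Fin n) 2) : Prop where
  le : i ≤ n
  hist_eq : ∀ q, hist q = {v | v.1 = side q ∧ v.2.val < i}
  goal_eq : ∀ q, goal q = if h : i < n then some (side q, ⟨i, h⟩) else none
  red_lt : ∀ q, ∀ v ∈ C.red q, v.2.val < i
  blue_lt : ∀ v ∈ C.blue, v.2.val < i

/-- All in-neighbours have a smaller index, so index `i` is ready; above it, the path predecessor
has not been computed yet. -/
theorem ladder_ready_iff {side : Fin 2 → Bool} (hside : Function.Surjective side) {i : ℕ}
    {hist : Fin 2 → Set (Bool × Fin n)}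
    (hh : ∀ q, hist q = {v | v.1 = side q ∧ v.2.val < i}) (v : Bool × Fin n) :
    IsReady (ladder n D) hist v ↔ v.2.val = i := by
  constructor
  · rintro ⟨h1, h2⟩
    have hv : i ≤ v.2.val := by
      obtain ⟨q, hq⟩ := hside v.1
      have := h1 q
      rw [hh q] at this
      by_contra hlt
      exact this ⟨hq.symm, by omega⟩
    by_contra hne
    have hp : ((v.1, ⟨v.2.val - 1, by omega⟩) : Bool × Fin n) ∈ (ladder n D).preds v :=
      Or.inl ⟨rfl, by dsimp only; omega⟩
    obtain ⟨q, hq⟩ := h2 _ hp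
    rw [hh q] at hq
    have := hq.2
    dsimp only at this
    omega
  · intro hv
    refine ⟨fun q hq => ?_, fun u hu => ?_⟩
    · rw [hh q] at hq
      exact absurd hq.2 (by omega)
    · obtain ⟨q, hq⟩ := hside (Prod.fst (show Bool × Fin n from u))
      refine ⟨q, ?_⟩
      rw [hh q]
      exact ⟨hq.symm, hv ▸ lt_of_mem_ladder_preds hu⟩

/-- With two ready nodes, both are taken. -/
theorem greedyChoice_of_two {rule : GreedyRule} {C : Config (Bool × Fin n) 2}
    {hist : Fin 2 → Set (Bool × Fin n)} {goal : Selection (Bool × Fin n) 2} {i : ℕ} (hi : i < n)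
    (hready : ∀ v : Bool × Fin n, IsReady (ladder n D) hist v ↔ v.2.val = i)
    (hc : IsGreedyChoice rule (ladder n D) C hist goal) :
    ∃ side : Fin 2 → Bool, Function.Bijective side ∧
      (∀ q, goal q = some (side q, ⟨i, hi⟩)) ∧
      ∃ q, ∀ w : Bool × Fin n, w.2.val = i →
        rule.score (ladder n D) C q w ≤
          rule.score (ladder n D) C q ((side q, ⟨i, hi⟩) : Bool × Fin n) := by
  obtain ⟨order, ho⟩ := hc
  have hsome : ∀ p, ∃ b, goal p = some (b, ⟨i, hi⟩) := by
    intro p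
    obtain ⟨h1, h2⟩ := ho p
    cases hg : goal p with
    | some v =>
      have := (hready v).1 (h2 v hg).1.1
      exact ⟨v.1, by rw [← Fin.ext_iff (a := v.2) (b := ⟨i, hi⟩)] at this; rw [← this]⟩
    | none =>
      exfalso
      have he := h1 hg
      -- If `p` got nothing, both nodes would be taken by processors other than `p`. There is only
      -- one such processor, and it has only one goal.
      have hb : ∀ b : Bool, ∃ q, order q < order p ∧ goal q = some (b, ⟨i, hi⟩) := by
        intro b
        by_contra hno
        push Not at hno
        have : ((b, ⟨i, hi⟩) : Bool × Fin n) ∈ {v : Bool × Fin n | IsReady (ladder n D) hist v ∧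
          ∀ q, order q < order p → goal q ≠ some v} := ⟨(hready _).2 rfl, hno⟩
        exact (Set.ext_iff.1 he _).1 this
      obtain ⟨q, hq, hgq⟩ := hb true
      obtain ⟨q', hq', hgq'⟩ := hb false
      have e1 : q ≠ p := by rintro rfl; exact lt_irrefl _ hq
      have e2 : q' ≠ p := by rintro rfl; exact lt_irrefl _ hq'
      have : q = q' := by omega
      subst this
      rw [hgq] at hgq'
      simp at hgq'
  choose side hs using hsome
  have hne : ∀ p q, order q < order p → side q ≠ side p := by
    intro p q hqp he
    have := ((ho p).2 _ (hs p)).1.2 q hqp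
    rw [hs q, he] at this
    exact this rfl
  have hinj : Function.Injective side := by
    intro p q hpq
    by_contra hpq'
    rcases lt_trichotomy (order p) (order q) with h | h | h
    · exact hne _ _ h hpq
    · exact hpq' (order.injective h)
    · exact hne _ _ h hpq.symm
  -- The processor `order.symm 0` chooses first, so nothing is taken yet and its goal is best among
  -- all ready nodes.
  refine ⟨side, (Fintype.bijective_iff_injective_and_card side).2 ⟨hinj, by simp⟩, hs,
    order.symm 0, fun w hw => ?_⟩
  refine ((ho _).2 _ (hs _)).2 w ⟨(hready w).2 hw, fun q hq => ?_⟩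
  simp at hq

/-- A processor that has just computed its node of index `i` prefers the next one on the path. -/
theorem score_lt_score (rule : GreedyRule) {C : Config (Bool × Fin n) 2} {q : Fin 2} {b : Bool}
    {i : ℕ} (hi : i + 1 < n) (h1 : ((b, ⟨i, by omega⟩) : Bool × Fin n) ∈ C.red q)
    (h2 : ((!b, ⟨i, by omega⟩) : Bool × Fin n) ∉ C.red q) :
    rule.score (ladder n D) C q ((!b, ⟨i + 1, hi⟩) : Bool × Fin n) <
      rule.score (ladder n D) C q ((b, ⟨i + 1, hi⟩) : Bool × Fin n) := by
  have e1 : ((ladder n D).preds ((b, ⟨i + 1, hi⟩) : Bool × Fin n) ∩ C.red q).ncard =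
      (rung n D (i + 1) ∩ C.red q).ncard + 1 := by
    rw [ladder_preds_succ, Set.insert_inter_of_mem h1,
      Set.ncard_insert_of_notMem (fun h => not_mem_rung_succ b _ h.1) (Set.toFinite _)]
  have e2 : ((ladder n D).preds ((!b, ⟨i + 1, hi⟩) : Bool × Fin n) ∩ C.red q).ncard =
      (rung n D (i + 1) ∩ C.red q).ncard := by
    rw [ladder_preds_succ, Set.insert_inter_of_notMem h2]
  -- Both candidates have the same positive in-degree, so fractions compare like counts and the
  -- convention for sources is irrelevant.
  have e3 : ∀ c, (ladder n D).inDegree ((c, ⟨i + 1, hi⟩) : Bool × Fin n) =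
      (rung n D (i + 1)).ncard + 1 := by
    intro c
    rw [CompDAG.inDegree, ladder_preds_succ,
      Set.ncard_insert_of_notMem (not_mem_rung_succ c _) (Set.toFinite _)]
  cases rule with
  | count =>
    simp only [GreedyRule.score, e1, e2]
    exact_mod_cast Nat.lt_succ_self _
  | fraction s =>
    simp only [GreedyRule.score, e1, e2, e3, Nat.succ_ne_zero, if_false]
    push_cast
    gcongr
    linarith

/-- Only the two sources are ready at the start; whichever of them a processor takes fixes its path
for good. -/
theorem Locked.init {rule : GreedyRule} {goal : Selection (Bool × Fin n) 2} (hn : 0 < n)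
    (hc : IsGreedyChoice rule (ladder n D) (Config.init _ 2) (fun _ => ∅) goal) :
    ∃ side : Fin 2 → Bool, Function.Bijective side ∧
      Locked D side 0 (Config.init _ 2) (fun _ => ∅) goal := by
  -- The histories are empty, so any assignment of paths describes them; the actual `side` comes
  -- from the choice.
  obtain ⟨f, hf⟩ : ∃ f : Fin 2 → Bool, Function.Surjective f :=
    ⟨fun q => decide (q = 0), by decide⟩
  obtain ⟨side, hb, hg, -⟩ := greedyChoice_of_two hn
    (ladder_ready_iff hf (i := 0) (fun q => by simp)) hc
  exact ⟨side, hb, ⟨Nat.zero_le _, fun q => Set.ext fun v => by simp, fun q => by simp [hg, hn],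
    fun q v h => h.elim, fun v h => h.elim⟩⟩

/-- Saves and loads only copy existing pebbles and removals only delete them, so no pebble reaches a
new index. -/
theorem Locked.other {side : Fin 2 → Bool} {i : ℕ} {C : Config (Bool × Fin n) 2}
    {hist : Fin 2 → Set (Bool × Fin n)} {goal : Selection (Bool × Fin n) 2}
    (h : Locked D side i C hist goal) {m : Move (Bool × Fin n) 2} (hm : ¬ m.IsCompute)
    (ha : m.Applicable (ladder n D) C) : Locked D side i (m.apply C) hist goal := by
  refine ⟨h.le, h.hist_eq, h.goal_eq, ?_, ?_⟩
  · intro q v hv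
    cases m with
    | save f => exact h.red_lt q v hv
    | load f => exact hv.elim (h.red_lt q v) fun hv => h.blue_lt v (ha.2 q v hv)
    | compute f => exact (hm trivial).elim
    | removeRed p w => exact h.red_lt q v hv.1
    | removeBlue w => exact h.red_lt q v hv
  · intro v hv
    cases m with
    | save f => exact hv.elim (h.blue_lt v) fun ⟨p, hp⟩ => h.red_lt p v (ha.2 p v hp)
    | load f => exact h.blue_lt v hv
    | compute f => exact (hm trivial).elim
    | removeRed p w => exact h.blue_lt v hv
    | removeBlue w => exact h.blue_lt v hv.1

theorem Locked.recompute {side : Fin 2 → Bool} {i : ℕ} {C : Config (Bool × Fin n) 2}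
    {hist : Fin 2 → Set (Bool × Fin n)} {goal : Selection (Bool × Fin n) 2}
    (h : Locked D side i C hist goal) {f : Selection (Bool × Fin n) 2}
    (hf : ∀ p v, f p = some v → v ∈ hist p) :
    Locked D side i ((Move.compute f).apply C) hist goal := by
  refine ⟨h.le, h.hist_eq, h.goal_eq, fun q v hv => hv.elim (h.red_lt q v) fun hv => ?_,
    h.blue_lt⟩
  have := hf q v hv
  rw [h.hist_eq] at this
  exact this.2

/-- The new goals are chosen right after both nodes of index `i` were computed, when each processor
holds its own node and not the opposite one. This makes `score_lt_score` applicable to the processor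
that chooses first; bijectivity settles the other. -/
theorem Locked.advance {rule : GreedyRule} {side : Fin 2 → Bool} (hside : Function.Bijective side)
    {i : ℕ} {C : Config (Bool × Fin n) 2} {hist : Fin 2 → Set (Bool × Fin n)}
    {goal goal' : Selection (Bool × Fin n) 2} (h : Locked D side i C hist goal) (hi : i < n)
    (hc : IsGreedyChoice rule (ladder n D)
      ((Move.compute fun q => some (side q, ⟨i, hi⟩)).apply C)
      (fun q => hist q ∪ {v | (some (side q, ⟨i, hi⟩) : Option (Bool × Fin n)) = some v}) goal') :
    Locked D side (i + 1) ((Move.compute fun q => some (side q, ⟨i, hi⟩)).apply C)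
      (fun q => hist q ∪ {v | (some (side q, ⟨i, hi⟩) : Option (Bool × Fin n)) = some v})
      goal' := by
  have hh : ∀ q, hist q ∪ {v | (some (side q, ⟨i, hi⟩) : Option (Bool × Fin n)) = some v} =
      {v | v.1 = side q ∧ v.2.val < i + 1} := by
    intro q
    rw [h.hist_eq]
    ext ⟨b, j⟩
    simp only [Set.mem_union, Set.mem_ofPred_eq, Option.some.injEq, Prod.ext_iff, Fin.ext_iff]
    constructor
    · rintro (⟨h1, h2⟩ | ⟨h1, h2⟩)
      · exact ⟨h1, by omega⟩
      · exact ⟨h1.symm, by omega⟩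
    · rintro ⟨h1, h2⟩
      by_cases hj : j.val < i
      · exact Or.inl ⟨h1, hj⟩
      · exact Or.inr ⟨h1.symm, by omega⟩
  have hready := ladder_ready_iff (D := D) hside.surjective hh
  refine ⟨hi, hh, ?_, ?_, fun v hv => (h.blue_lt v hv).trans (Nat.lt_succ_self i)⟩
  · by_cases hi' : i + 1 < n
    · obtain ⟨side', hb, hg, q, hq⟩ := greedyChoice_of_two hi' hready hc
      have hpref := score_lt_score (D := D) rule (q := q) (b := side q) hi'
        (C := (Move.compute fun q => some (side q, ⟨i, hi⟩)).apply C)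
        (Or.inr (show (some _ : Option (Bool × Fin n)) = some _ from rfl)) (by
          rintro (h' | h')
          · exact absurd (h.red_lt _ _ h') (by simp)
          · simp at h')
      have hq' : side' q = side q := by
        by_contra hne
        have e : side' q = !side q := by revert hne; cases side' q <;> cases side q <;> simp
        have := hq (side q, ⟨i + 1, hi'⟩) rfl
        rw [e] at this
        exact absurd this (not_le.2 hpref)
      intro p
      rw [dif_pos hi', hg p]
      by_cases hpq : p = q
      · rw [hpq, hq']
      · have a1 : side' p ≠ side' q := fun h => hpq (hb.injective h)
        have a2 : side p ≠ side q := fun h => hpq (hside.injective h)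
        have : side' p = side p := by
          rw [hq'] at a1
          revert a1 a2
          cases side' p <;> cases side p <;> cases side q <;> simp
        rw [this]
    · intro p
      rw [dif_neg hi']
      cases hgp : goal' p with
      | none => rfl
      | some v =>
        obtain ⟨order, ho⟩ := hc
        have := (hready v).1 (((ho p).2 v hgp).1.1)
        have := v.2.2
        omega
  · rintro q v (hv | hv)
    · exact (h.red_lt q v hv).trans (Nat.lt_succ_self i)
    · have : (side q, ⟨i, hi⟩) = v := Option.some.inj hv
      rw [← this]
      exact Nat.lt_succ_self i

/-- A lower bound for the cost of greedy strategies by a potential function `Φ`, where `Φ i` is used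
while the nodes with index `i` are the next-goal nodes. -/
theorem GreedyFrom.potential_bound {rule : GreedyRule} {side : Fin 2 → Bool}
    (hside : Function.Bijective side) (hn : 0 < n) {g r : ℕ}
    (Φ : ℕ → Config (Bool × Fin n) 2 → ℕ) (bound : ℕ → ℕ) (hend : bound n = 0)
    (hother : ∀ i C (m : Move (Bool × Fin n) 2), ¬ m.IsCompute → m.Applicable (ladder n D) C →
      Φ i (m.apply C) ≤ Φ i C + m.cost g)
    (hrec : ∀ i C (f : Selection (Bool × Fin n) 2), (∀ p v, f p = some v → v.1 = side p) →
      Φ i ((Move.compute f).apply C) ≤ Φ i C + 1)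
    (hadv : ∀ i C (hi : i < n),
      (∀ q, (ladder n D).preds ((side q, ⟨i, hi⟩) : Bool × Fin n) ⊆ C.red q) →
      ((Move.compute fun q => some (side q, ⟨i, hi⟩)).apply C).Valid r →
      bound i + Φ (i + 1) ((Move.compute fun q => some (side q, ⟨i, hi⟩)).apply C) ≤
        bound (i + 1) + Φ i C + 1)
    {C : Config (ladder n D).V 2} {hist : Fin 2 → Set (ladder n D).V}
    {goal : Selection (ladder n D).V 2} {P : List (Move (ladder n D).V 2)}
    (hP : GreedyFrom rule (ladder n D) C hist goal P) :
    ∀ i, Locked D side i C hist goal → PebblesFrom (ladder n D) r C P →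
      bound i ≤ Φ i C + pebblingCost g P := by
  induction hP with
  | done C hist goal =>
    intro i hL hT
    -- A pebbled last node forces `i = n`, where the bound vanishes.
    have hsink : ((false, ⟨n - 1, by omega⟩) : Bool × Fin n) ∈ (ladder n D).sinks := by
      intro w hw
      have h1 := lt_of_mem_ladder_preds (D := D) hw
      have h2 := (Prod.snd (show Bool × Fin n from w)).2
      dsimp only at h1
      omega
    have : n - 1 < i := by
      rcases hT _ hsink with h | ⟨p, h⟩
      · exact hL.blue_lt _ h
      · exact hL.red_lt _ _ h
    have := hL.le
    obtain rfl : i = n := by omega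
    omega
  | other C hist goal m P hm h ih =>
    intro i hL hT
    have h1 := ih i (hL.other hm hT.1) hT.2.2
    have h2 := hother i C m hm hT.1
    have h3 : pebblingCost g (m :: P) = m.cost g + pebblingCost g P := by simp [pebblingCost]
    omega
  | recompute C hist goal f P hf h ih =>
    intro i hL hT
    have h1 := ih i (hL.recompute hf) hT.2.2
    have h2 := hrec i C f fun p v hv => by
      have := hf p v hv
      rw [hL.hist_eq] at this
      exact this.1
    have h3 : pebblingCost g (Move.compute f :: P) = 1 + pebblingCost g P := by
      simp [pebblingCost, Move.cost]
    omega
  | advance C hist goal goal' f P hgoal hidle hchoice h ih =>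
    intro i hL hT
    have h3 : pebblingCost g (Move.compute f :: P) = 1 + pebblingCost g P := by
      simp [pebblingCost, Move.cost]
    by_cases hi : i < n
    · obtain rfl : f = fun q => some (side q, ⟨i, hi⟩) := by
        funext q
        exact hgoal q _ (by rw [hL.goal_eq, dif_pos hi])
      have h1 := ih (i + 1) (hL.advance hside hi hchoice) hT.2.2
      have h2 := hadv i C hi (fun q => hT.1.2 q _ rfl) hT.2.1
      omega
    · have := hL.le
      obtain rfl : i = n := by omega
      omega

/-- The potential bound for a greedy pebbling. -/
theorem IsGreedyPebbling.potential_bound {rule : GreedyRule} (hn : 0 < n) {g r : ℕ}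
    (Φ : Fin 2 → ℕ → Config (Bool × Fin n) 2 → ℕ) (bound : ℕ → ℕ) (hend : bound n = 0)
    (hother : ∀ p i C (m : Move (Bool × Fin n) 2), ¬ m.IsCompute →
      m.Applicable (ladder n D) C → Φ p i (m.apply C) ≤ Φ p i C + m.cost g)
    (hrec : ∀ p i C (f : Selection (Bool × Fin n) 2), (∀ v, f p = some v → v.1 = true) →
      Φ p i ((Move.compute f).apply C) ≤ Φ p i C + 1)
    (hadv : ∀ p i C (f : Selection (Bool × Fin n) 2) (hi : i < n), f p = some (true, ⟨i, hi⟩) →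
      (ladder n D).preds ((true, ⟨i, hi⟩) : Bool × Fin n) ⊆ C.red p →
      ((Move.compute f).apply C).Valid r →
      bound i + Φ p (i + 1) ((Move.compute f).apply C) ≤ bound (i + 1) + Φ p i C + 1)
    {P : List (Move (Bool × Fin n) 2)} (hP : IsGreedyPebbling rule (ladder n D) 2 r P) :
    ∃ p, bound 0 ≤ Φ p 0 (Config.init _ 2) + pebblingCost g P := by
  obtain ⟨hpeb, goal, hc, hfrom⟩ := hP
  obtain ⟨side, hb, hL⟩ := Locked.init hn hc
  -- Which processor follows the `true` path depends on the pebbling, hence the parameter `p` of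
  -- `Φ`.
  obtain ⟨p, hp⟩ := hb.surjective true
  refine ⟨p, GreedyFrom.potential_bound hb hn (Φ p) bound hend (hother p) ?_ ?_ hfrom 0 hL hpeb⟩
  · intro i C f hf
    exact hrec p i C f fun v hv => (hf p v hv).trans hp
  · intro i C hi h1 h2
    have := h1 p
    rw [hp] at this
    exact hadv p i C _ hi (by rw [hp]) this h2

/-! ### Lower bounds for greedy pebblings -/

/-- A processor handles one node per step; this limits the growth of the potentials to `g` per I/O
step. -/
theorem ncard_inter_union_some_le {V : Type} [Finite V] (S A : Set V) (o : Option V) :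
    (S ∩ (A ∪ {v | o = some v})).ncard ≤ (S ∩ A).ncard + 1 := by
  cases o with
  | none =>
    refine (Set.ncard_le_ncard ?_ (Set.toFinite _)).trans (Nat.le_succ _)
    rintro v ⟨h1, h2 | h2⟩
    · exact ⟨h1, h2⟩
    · cases h2
  | some w =>
    refine (Set.ncard_le_ncard ?_ (Set.toFinite _)).trans (Set.ncard_insert_le w _)
    rintro v ⟨h1, h2 | h2⟩
    · exact Or.inr ⟨h1, h2⟩
    · exact Or.inl (Option.some.inj h2).symm

/-- Two blocks of `m` indices each, used alternately by the indices above `2 * m`. -/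
def alternatingBlocks (m j : ℕ) : Finset ℕ :=
  if 2 * m < j then Finset.Ico (m * (j % 2)) (m * (j % 2) + m) else ∅

theorem mem_alternatingBlocks {m j i : ℕ} :
    i ∈ alternatingBlocks m j ↔ 2 * m < j ∧ m * (j % 2) ≤ i ∧ i < m * (j % 2) + m := by
  unfold alternatingBlocks
  split_ifs with h <;> simp [h]

theorem block_lt {m i c : ℕ} (hc : c < 2) (h : i < m * c + m) : i < 2 * m := by
  interval_cases c <;> omega

theorem ncard_rung_alternatingBlocks {m j : ℕ} (hj : 2 * m < j) (hn : 2 * m ≤ n) :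
    (rung n (alternatingBlocks m) j).ncard = m := by
  have h1 : rung n (alternatingBlocks m) j =
      {u | u.1 = false ∧ u.2.val ∈ alternatingBlocks m j} := by
    ext u
    refine and_congr_right fun _ => and_iff_right_of_imp fun h => ?_
    have := block_lt (Nat.mod_lt j two_pos) (mem_alternatingBlocks.1 h).2.2
    omega
  rw [h1, ncard_row]
  · simp [alternatingBlocks, hj]
  · intro i h
    have := block_lt (Nat.mod_lt j two_pos) (mem_alternatingBlocks.1 h).2.2
    omega

theorem rung_alternatingBlocks_eq_empty {m j : ℕ} (hj : j ≤ 2 * m) :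
    rung n (alternatingBlocks m) j = ∅ := by
  ext u
  simp only [rung, mem_alternatingBlocks, Set.mem_ofPred_eq, Set.mem_empty_iff_false, iff_false]
  omega

theorem ncard_rung_alternatingBlocks_le (m j : ℕ) (hn : 2 * m ≤ n) :
    (rung n (alternatingBlocks m) j).ncard ≤ m := by
  rcases le_or_gt j (2 * m) with h | h
  · simp [rung_alternatingBlocks_eq_empty h]
  · exact (ncard_rung_alternatingBlocks h hn).le

/-- Consecutive indices have opposite parity and so use different blocks. This is what forces a full
reload at every stage. -/
theorem rung_alternatingBlocks_disjoint {m j : ℕ} {u : Bool × Fin n}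
    (h : u ∈ rung n (alternatingBlocks m) j) : u ∉ rung n (alternatingBlocks m) (j + 1) := by
  intro h'
  have h1 := mem_alternatingBlocks.1 h.2.2
  have h2 := mem_alternatingBlocks.1 h'.2.2
  rcases Nat.mod_two_eq_zero_or_one j with h0 | h0
  · rw [h0] at h1
    rw [show (j + 1) % 2 = 1 by omega] at h2
    omega
  · rw [h0] at h1
    rw [show (j + 1) % 2 = 0 by omega] at h2
    omega

/-- With small memory, each stage of a greedy pebbling loads a whole block. -/
theorem greedy_cost_alternatingBlocks {rule : GreedyRule} {m g : ℕ} (hn : 2 * m < n)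
    {P : List (Move (Bool × Fin n) 2)}
    (hP : IsGreedyPebbling rule (ladder n (alternatingBlocks m)) 2 (m + 2) P) :
    n * (g * m + 1) ≤ 2 * (g * m + 1) * (2 * m + 1) + pebblingCost g P := by
  -- The first summand counts the part of the current rung already in memory, at `g` per node. The
  -- second is a starting credit for the indices up to `2 * m`, which have no rung: twice the stage
  -- cost pays for the stage and for a first summand that may grow to `g * m`.
  refine Exists.elim (IsGreedyPebbling.potential_bound (g := g) (by omega)
    (fun p i C => g * (rung n (alternatingBlocks m) i ∩ C.red p).ncard +
      2 * (g * m + 1) * (2 * m + 1 - i)) (fun i => (n - i) * (g * m + 1)) (by simp)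
    ?_ ?_ ?_ hP)
    fun p hp => by simpa [Config.init] using hp
  · intro p i C mv hm ha
    have key : ∀ A : Set (Bool × Fin n), A ⊆ C.red p →
        g * (rung n (alternatingBlocks m) i ∩ A).ncard ≤
          g * (rung n (alternatingBlocks m) i ∩ C.red p).ncard := fun A hA =>
      Nat.mul_le_mul_left _ (Set.ncard_le_ncard (Set.inter_subset_inter_right _ hA)
        (Set.toFinite _))
    cases mv with
    | save f => have := key _ subset_rfl; simp only [Move.apply]; omega
    | load f =>
      have h1 := Nat.mul_le_mul_left g (ncard_inter_union_some_le
        (rung n (alternatingBlocks m) i) (C.red p) (f p))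
      simp only [Move.apply, Move.cost]
      rw [mul_add_one] at h1
      omega
    | compute f => exact (hm trivial).elim
    | removeRed q w =>
      have := key _ (fun v hv => hv.1 : ((Move.removeRed q w).apply C).red p ⊆ C.red p)
      omega
    | removeBlue w => have := key _ subset_rfl; simp only [Move.apply]; omega
  · intro p i C f hf
    have : rung n (alternatingBlocks m) i ∩ ((Move.compute f).apply C).red p ⊆
        rung n (alternatingBlocks m) i ∩ C.red p := by
      rintro v ⟨h1, h2 | h2⟩
      · exact ⟨h1, h2⟩
      · exact absurd (hf v h2) (by simp [h1.1])
    have := Nat.mul_le_mul_left g (Set.ncard_le_ncard this (Set.toFinite _))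
    omega
  · intro p i C f hi hf hpre hval
    have hni : (n - i) * (g * m + 1) = (n - (i + 1)) * (g * m + 1) + (g * m + 1) := by
      rw [show n - i = n - (i + 1) + 1 by omega, add_one_mul]
    rw [hni]
    rcases le_or_gt i (2 * m) with him | him
    · have h1 : (rung n (alternatingBlocks m) (i + 1) ∩ ((Move.compute f).apply C).red p).ncard ≤
          m := (Set.ncard_le_ncard Set.inter_subset_left (Set.toFinite _)).trans
            (ncard_rung_alternatingBlocks_le _ _ hn.le)
      have h2 := Nat.mul_le_mul_left g h1
      rw [show 2 * m + 1 - i = (2 * m + 1 - (i + 1)) + 1 by omega,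
        mul_add_one (2 * (g * m + 1))]
      omega
    · obtain ⟨i, rfl⟩ : ∃ j, i = j + 1 := ⟨i - 1, by omega⟩
      rw [ladder_preds_succ] at hpre
      have h1 : rung n (alternatingBlocks m) (i + 1) ∩ C.red p =
          rung n (alternatingBlocks m) (i + 1) :=
        Set.inter_eq_left.2 fun v hv => hpre (Or.inr hv)
      -- The new node, its path predecessor and the rung already make `m + 2` red pebbles, so there
      -- is no other one.
      have hsub : insert (true, ⟨i + 1, hi⟩) (insert (true, ⟨i, by omega⟩)
          (rung n (alternatingBlocks m) (i + 1))) ⊆ ((Move.compute f).apply C).red p := by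
        rintro v (rfl | hv)
        · exact Or.inr hf
        · exact Or.inl (hpre hv)
      have hcard : (insert (true, ⟨i + 1, hi⟩) (insert (true, ⟨i, by omega⟩)
          (rung n (alternatingBlocks m) (i + 1)))).ncard = m + 2 := by
        rw [Set.ncard_insert_of_notMem _ (Set.toFinite _),
          Set.ncard_insert_of_notMem _ (Set.toFinite _), ncard_rung_alternatingBlocks him hn.le]
        · simp [rung]
        · simp [rung]
      have heq := Set.eq_of_subset_of_ncard_le hsub (by rw [hcard]; exact hval p) (Set.toFinite _)
      have h2 : rung n (alternatingBlocks m) (i + 1 + 1) ∩ ((Move.compute f).apply C).red p = ∅ := by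
        rw [← heq, Set.eq_empty_iff_forall_notMem]
        rintro v ⟨hv, rfl | rfl | hv'⟩
        · exact absurd hv.1 (by simp)
        · exact absurd hv.1 (by simp)
        · exact rung_alternatingBlocks_disjoint hv' hv
      rw [h1, h2, ncard_rung_alternatingBlocks him hn.le, Set.ncard_empty,
        show 2 * m + 1 - (i + 1) = 0 by omega, show 2 * m + 1 - (i + 1 + 1) = 0 by omega]
      omega

/-- The nodes of the `false` path that are still needed for nodes of index at least `i`, if the
node of index `j` needs the one of index `j - 2`. -/
def needed (n i : ℕ) : Set (Bool × Fin n) :=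
  {v | v.1 = false ∧ i ≤ v.2.val + 2 ∧ v.2.val + 2 < n}

theorem needed_succ_of_lt {i : ℕ} (hi : i < 2) : needed n (i + 1) = needed n i := by
  ext v
  exact and_congr_right fun _ => and_congr_left fun _ => by omega

theorem needed_eq_insert {i : ℕ} (hi : i + 2 < n) :
    needed n (i + 2) = insert (false, ⟨i, by omega⟩) (needed n (i + 2 + 1)) := by
  ext ⟨b, j⟩
  simp only [needed, Set.mem_ofPred_eq, Set.mem_insert_iff, Prod.ext_iff, Fin.ext_iff]
  constructor
  · rintro ⟨h1, h2, h3⟩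
    by_cases h : j.val = i
    · exact Or.inl ⟨h1, h⟩
    · exact Or.inr ⟨h1, by omega, h3⟩
  · rintro (⟨h1, h2⟩ | ⟨h1, h2, h3⟩)
    · exact ⟨h1, by omega, by omega⟩
    · exact ⟨h1, by omega, h3⟩

/-- Whatever the memory size, each stage of a greedy pebbling needs a save and a load. -/
theorem greedy_cost_shift {rule : GreedyRule} {r g : ℕ} (hn : 2 ≤ n)
    {P : List (Move (Bool × Fin n) 2)}
    (hP : IsGreedyPebbling rule (ladder n fun j => {j - 2}) 2 r P) :
    n + 2 * g * (n - 2) ≤ pebblingCost g P := by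
  -- Each needed node earns `g` once it is available to `p` (red or blue) and another `g` once it is
  -- red: the prices of its save and of its load. In the bound, `max i 2` reflects that the indices
  -- 0 and 1 have no rung.
  refine Exists.elim (IsGreedyPebbling.potential_bound (g := g) (by omega)
    (fun p i C => g * ((needed n i ∩ C.red p).ncard + (needed n i ∩ (C.red p ∪ C.blue)).ncard))
    (fun i => (n - i) + 2 * g * (n - max i 2)) (by simp [hn]) ?_ ?_ ?_ hP)
    fun p hp => by simpa [Config.init] using hp
  · intro p i C mv hm ha
    have key : ∀ A B : Set (Bool × Fin n), A ⊆ C.red p → B ⊆ C.red p ∪ C.blue →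
        g * ((needed n i ∩ A).ncard + (needed n i ∩ B).ncard) ≤
          g * ((needed n i ∩ C.red p).ncard + (needed n i ∩ (C.red p ∪ C.blue)).ncard) :=
      fun A B hA hB => Nat.mul_le_mul_left _ (Nat.add_le_add
        (Set.ncard_le_ncard (Set.inter_subset_inter_right _ hA) (Set.toFinite _))
        (Set.ncard_le_ncard (Set.inter_subset_inter_right _ hB) (Set.toFinite _)))
    cases mv with
    | save f =>
      -- What `p` itself saves is red for `p` and already counted, so a joint save adds only the
      -- node of `p'`.
      obtain ⟨p', hp'⟩ : ∃ p' : Fin 2, ∀ q, q = p ∨ q = p' := by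
        refine ⟨1 - p, fun q => ?_⟩
        omega
      have h1 := ncard_inter_union_some_le (needed n i) (C.red p ∪ C.blue) (f p')
      have h2 : (needed n i ∩ (C.red p ∪ (C.blue ∪ {v | ∃ p, f p = some v}))).ncard ≤
          (needed n i ∩ (C.red p ∪ C.blue ∪ {v | f p' = some v})).ncard := by
        refine Set.ncard_le_ncard (Set.inter_subset_inter_right _ ?_) (Set.toFinite _)
        rintro v (hv | hv | ⟨q, hv⟩)
        · exact Or.inl (Or.inl hv)
        · exact Or.inl (Or.inr hv)
        · rcases hp' q with rfl | rfl
          · exact Or.inl (Or.inl (ha.2 q v hv))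
          · exact Or.inr hv
      simp only [Move.apply, Move.cost]
      rw [← Nat.mul_add_one]
      exact Nat.mul_le_mul_left g (by omega)
    | load f =>
      have h1 := ncard_inter_union_some_le (needed n i) (C.red p) (f p)
      have h2 : (needed n i ∩ (C.red p ∪ {v | f p = some v} ∪ C.blue)).ncard ≤
          (needed n i ∩ (C.red p ∪ C.blue)).ncard := by
        refine Set.ncard_le_ncard (Set.inter_subset_inter_right _ ?_) (Set.toFinite _)
        rintro v ((hv | hv) | hv)
        · exact Or.inl hv
        · exact Or.inr (ha.2 p v hv)
        · exact Or.inr hv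
      simp only [Move.apply, Move.cost]
      rw [← Nat.mul_add_one]
      exact Nat.mul_le_mul_left g (by omega)
    | compute f => exact (hm trivial).elim
    | removeRed q w =>
      exact (key _ _ (fun v hv => hv.1) (Set.union_subset_union_left _ fun v hv => hv.1)).trans
        (Nat.le_add_right _ _)
    | removeBlue w =>
      exact (key _ _ subset_rfl (Set.union_subset_union_right _ fun v hv => hv.1)).trans
        (Nat.le_add_right _ _)
  · intro p i C f hf
    refine (Nat.mul_le_mul_left g (Nat.add_le_add (Set.ncard_le_ncard ?_ (Set.toFinite _))
      (Set.ncard_le_ncard ?_ (Set.toFinite _)))).trans (Nat.le_succ _)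
    · rintro v ⟨h1, h2 | h2⟩
      · exact ⟨h1, h2⟩
      · exact absurd (hf v h2) (by simp [h1.1])
    · rintro v ⟨h1, (h2 | h2) | h2⟩
      · exact ⟨h1, Or.inl h2⟩
      · exact absurd (hf v h2) (by simp [h1.1])
      · exact ⟨h1, Or.inr h2⟩
  · intro p i C f hi hf hpre hval
    have hred : ∀ B : Set (Bool × Fin n),
        needed n (i + 1) ∩ (((Move.compute f).apply C).red p ∪ B) ⊆
          needed n (i + 1) ∩ (C.red p ∪ B) := by
      rintro B v ⟨h1, (h2 | h2) | h2⟩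
      · exact ⟨h1, Or.inl h2⟩
      · rw [hf] at h2
        rw [← Option.some.inj h2] at h1
        exact absurd h1.1 (by simp)
      · exact ⟨h1, Or.inr h2⟩
    have a1 := Set.ncard_le_ncard (hred ∅) (Set.toFinite _)
    have a2 := Set.ncard_le_ncard (hred C.blue) (Set.toFinite _)
    simp only [Set.union_empty] at a1
    have a3 : ((Move.compute f).apply C).blue = C.blue := rfl
    rw [a3]
    have a4 := Nat.mul_le_mul_left g (Nat.add_le_add a1 a2)
    rcases Nat.lt_or_ge i 2 with hi2 | hi2
    · rw [needed_succ_of_lt hi2] at a4 ⊢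
      rw [max_eq_right hi2.le, max_eq_right (show i + 1 ≤ 2 by omega)]
      omega
    · obtain ⟨i, rfl⟩ : ∃ j, i = j + 2 := ⟨i - 2, by omega⟩
      -- This node is used for the last time by `p` on its path: it is red, so it leaves both
      -- counts, and the drop of `2 * g` pays for the stage.
      have hmem : ((false, ⟨i, by omega⟩) : Bool × Fin n) ∈ C.red p :=
        hpre (Or.inr ⟨rfl, by simp, by simp⟩)
      have hnot : ∀ A : Set (Bool × Fin n), ((false, ⟨i, by omega⟩) : Bool × Fin n) ∉
          needed n (i + 2 + 1) ∩ A := fun A h => absurd h.1.2.1 (by simp)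
      rw [needed_eq_insert hi, Set.insert_inter_of_mem hmem,
        Set.insert_inter_of_mem (show _ ∈ C.red p ∪ C.blue from Or.inl hmem), Set.ncard_insert_of_notMem (hnot _) (Set.toFinite _),
        Set.ncard_insert_of_notMem (hnot _) (Set.toFinite _),
        max_eq_left (show 2 ≤ i + 2 by omega), max_eq_left (show 2 ≤ i + 2 + 1 by omega)]
      obtain ⟨d, rfl⟩ : ∃ d, n = i + 2 + 1 + d := ⟨n - (i + 2 + 1), by omega⟩
      rw [show i + 2 + 1 + d - (i + 2) = d + 1 by omega,
        show i + 2 + 1 + d - (i + 2 + 1) = d by omega]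
      nlinarith [a4]

/-! ### Upper bounds for the optimum -/

/-- From the configuration `C`, a pebbling can be finished with cost at most `c`. -/
def FinishableWithin {k : ℕ} (G : CompDAG) (r g : ℕ) (C : Config G.V k) (c : ℕ) : Prop :=
  ∃ P, PebblesFrom G r C P ∧ pebblingCost g P ≤ c

namespace FinishableWithin

variable {k r g c c' : ℕ} {G : CompDAG}

theorem mono {C : Config G.V k} (h : FinishableWithin G r g C c) (hc : c ≤ c') :
    FinishableWithin G r g C c' :=
  let ⟨P, h1, h2⟩ := h
  ⟨P, h1, h2.trans hc⟩

theorem opt_le (h : FinishableWithin G r g (Config.init G.V k) c) : pebblingOPT G k r g ≤ c :=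
  let ⟨P, h1, h2⟩ := h
  le_trans (Nat.sInf_le ⟨P, h1, rfl⟩) h2

theorem of_terminal {C : Config G.V k} (h : C.Terminal G) : FinishableWithin G r g C 0 :=
  ⟨[], h, le_rfl⟩

theorem step {C : Config G.V k} (m : Move G.V k) (ha : m.Applicable G C)
    (hv : (m.apply C).Valid r) (h : FinishableWithin G r g (m.apply C) c) :
    FinishableWithin G r g C (c + m.cost g) :=
  let ⟨P, h1, h2⟩ := h
  ⟨m :: P, ⟨ha, hv, h1⟩, by simp only [pebblingCost, List.map_cons, List.sum_cons] at h2 ⊢; omega⟩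

/-- Red pebbles can be dropped for free. -/
theorem drop {R R' : Fin k → Set G.V} {B : Set G.V} (hsub : ∀ p, R' p ⊆ R p)
    (hv : (⟨R, B⟩ : Config G.V k).Valid r) (h : FinishableWithin G r g ⟨R', B⟩ c) :
    FinishableWithin G r g ⟨R, B⟩ c := by
  have := G.finite
  induction hN : ∑ p, (R p \ R' p).ncard generalizing R with
  | zero =>
    have : R = R' := by
      funext p
      have h0 := (Finset.sum_eq_zero_iff.1 hN) p (Finset.mem_univ p)
      rw [Set.ncard_eq_zero (Set.toFinite _), Set.sdiff_eq_empty] at h0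
      exact h0.antisymm (hsub p)
    rwa [this]
  | succ N ih =>
    obtain ⟨p, -, hp⟩ := Finset.exists_ne_zero_of_sum_ne_zero (hN.trans_ne N.succ_ne_zero)
    obtain ⟨v, hv1, hv2⟩ := Set.nonempty_of_ncard_ne_zero hp
    have hle : ∀ q, {w | w ∈ R q ∧ ¬ (q = p ∧ w = v)} ⊆ R q := fun q w hw => hw.1
    have hval : ((Move.removeRed p v).apply (⟨R, B⟩ : Config G.V k)).Valid r := fun q =>
      (Set.ncard_le_ncard (hle q) (Set.toFinite _)).trans (hv q)
    refine step (c := c) (Move.removeRed p v) hv1 hval (ih (fun q w hw => ⟨hsub q hw, ?_⟩) hval ?_)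
    · rintro ⟨rfl, rfl⟩
      exact hv2 hw
    · have : ∑ q, (R q \ R' q).ncard =
          ∑ q, ({w | w ∈ R q ∧ ¬ (q = p ∧ w = v)} \ R' q).ncard + 1 := by
        rw [← Finset.add_sum_erase _ _ (Finset.mem_univ p),
          ← Finset.add_sum_erase _ _ (Finset.mem_univ p), add_right_comm]
        congr 1
        · have : R p \ R' p = insert v ({w | w ∈ R p ∧ ¬ (p = p ∧ w = v)} \ R' p) := by
            ext w
            by_cases hw : w = v
            · subst hw
              simp [hv1, hv2]
            · simp [hw]
          rw [this, Set.ncard_insert_of_notMem (by simp) (Set.toFinite _)]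
        · refine Finset.sum_congr rfl fun q hq => ?_
          congr 1
          ext w
          simp [Finset.ne_of_mem_erase hq]
      change ∑ q, ({w | w ∈ R q ∧ ¬ (q = p ∧ w = v)} \ R' q).ncard = N
      omega

/-- Loading nodes one by one. -/
theorem loadAll {R R' : Fin k → Set G.V} {B : Set G.V} (hsub : ∀ p, R p ⊆ R' p)
    (hB : ∀ p, R' p ⊆ R p ∪ B) (hv : (⟨R', B⟩ : Config G.V k).Valid r)
    (h : FinishableWithin G r g ⟨R', B⟩ c) :
    FinishableWithin G r g ⟨R, B⟩ (c + g * ∑ p, (R' p \ R p).ncard) := by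
  have := G.finite
  induction hN : ∑ p, (R' p \ R p).ncard generalizing R with
  | zero =>
    have : R = R' := by
      funext p
      have h0 := (Finset.sum_eq_zero_iff.1 hN) p (Finset.mem_univ p)
      rw [Set.ncard_eq_zero (Set.toFinite _), Set.sdiff_eq_empty] at h0
      exact (hsub p).antisymm h0
    rw [this]
    simpa using h
  | succ N ih =>
    obtain ⟨p, -, hp⟩ := Finset.exists_ne_zero_of_sum_ne_zero (hN.trans_ne N.succ_ne_zero)
    obtain ⟨v, hv1, hv2⟩ := Set.nonempty_of_ncard_ne_zero hp
    -- Loading for a single processor at a time wastes parallelism, but serves only the start-up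
    -- phase.
    let f : Selection G.V k := fun q => if q = p then some v else none
    have hf : ∀ q w, f q = some w ↔ q = p ∧ w = v := by
      intro q w
      by_cases hq : q = p
      · simp [f, hq, eq_comm]
      · simp [f, hq]
    have hle : ∀ q, R q ∪ {w | f q = some w} ⊆ R' q := by
      rintro q w (hw | hw)
      · exact hsub q hw
      · obtain ⟨rfl, rfl⟩ := (hf q w).1 hw
        exact hv1
    have hval : ((Move.load f).apply (⟨R, B⟩ : Config G.V k)).Valid r := fun q =>
      (Set.ncard_le_ncard (hle q) (Set.toFinite _)).trans (hv q)
    have key : FinishableWithin G r g ((Move.load f).apply ⟨R, B⟩) (c + g * N) := by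
      refine ih hle (fun q w hw => ?_) ?_
      · rcases hB q hw with h | h
        · exact Or.inl (Or.inl h)
        · exact Or.inr h
      · have : ∑ q, (R' q \ R q).ncard = ∑ q, (R' q \ (R q ∪ {w | f q = some w})).ncard + 1 := by
          rw [← Finset.add_sum_erase _ _ (Finset.mem_univ p),
            ← Finset.add_sum_erase _ _ (Finset.mem_univ p), add_right_comm]
          congr 1
          · have : R' p \ R p = insert v (R' p \ (R p ∪ {w | f p = some w})) := by
              ext w
              by_cases hw : w = v
              · subst hw
                simp [hv1, hv2]
              · simp [hw, hf]
            rw [this, Set.ncard_insert_of_notMem (by simp [hf]) (Set.toFinite _)]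
          · refine Finset.sum_congr rfl fun q hq => ?_
            congr 1
            ext w
            simp [hf, Finset.ne_of_mem_erase hq]
        change ∑ q, (R' q \ (R q ∪ {w | f q = some w})).ncard = N
        omega
    refine (step (Move.load f) ⟨⟨p, v, (hf p v).2 ⟨rfl, rfl⟩⟩, fun q w hw => ?_⟩ hval key).mono ?_
    · obtain ⟨rfl, rfl⟩ := (hf q w).1 hw
      exact (hB q hv1).resolve_left hv2
    · change c + g * N + g ≤ c + g * (N + 1)
      rw [mul_add_one]
      omega

/-- Computing some nodes in one step, saving them, and then dropping red pebbles. -/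
theorem computeSave {R R' : Fin k → Set G.V} {B : Set G.V} (f : Selection G.V k)
    (hf : ∃ p v, f p = some v) (hpre : ∀ p v, f p = some v → G.preds v ⊆ R p)
    (hsub : ∀ p, R' p ⊆ R p) (hv : ∀ p, (R p ∪ {v | f p = some v}).ncard ≤ r)
    (h : FinishableWithin G r g ⟨R', B ∪ {v | ∃ p, f p = some v}⟩ c) :
    FinishableWithin G r g ⟨R, B⟩ (c + (g + 1)) := by
  refine step (c := c + g) (Move.compute f) ⟨hf, hpre⟩ hv ?_
  refine step (c := c) (Move.save f) ⟨hf, fun p v hpv => Or.inr hpv⟩ hv ?_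
  exact drop (fun p v hv' => Or.inl (hsub p hv')) hv h

end FinishableWithin

open FinishableWithin

/-- With unbounded memory, one can compute all nodes without communication. -/
theorem opt_ladder_le {r g : ℕ} (hr : (ladder n D).size ≤ r) :
    pebblingOPT (ladder n D) 2 r g ≤ 2 * n := by
  have hval : ∀ C : Config (Bool × Fin n) 2, C.Valid r := fun C p =>
    ((Set.ncard_le_ncard (Set.subset_univ _) (Set.toFinite _)).trans_eq
      (Set.ncard_univ _)).trans hr
  have key : ∀ d i, i + d = n → FinishableWithin (ladder n D) r g
      (⟨fun _ => {v | v.2.val < i}, ∅⟩ : Config (Bool × Fin n) 2) (2 * d) := by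
    intro d
    induction d with
    | zero =>
      intro i hi
      refine of_terminal fun v _ => Or.inr ⟨0, ?_⟩
      have := (Prod.snd (show Bool × Fin n from v)).2
      exact lt_of_lt_of_le this (by omega)
    | succ d ih =>
      intro i hi
      have hi' : i < n := by omega
      have := ih (i + 1) (by omega)
      -- Both processors compute the same nodes: a joint step costs no more than a single one, and
      -- the red sets stay equal.
      refine step (c := 2 * d + 1) (Move.compute fun _ => some (false, ⟨i, hi'⟩))
        ⟨⟨0, _, rfl⟩, ?_⟩ (hval _) (step (c := 2 * d)
          (Move.compute fun _ => some (true, ⟨i, hi'⟩)) ⟨⟨0, _, rfl⟩, ?_⟩ (hval _) ?_)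
      · rintro p v hv u hu
        have h2 := lt_of_mem_ladder_preds hu
        rw [← Option.some.inj hv] at h2
        exact h2
      · rintro p v hv u hu
        have h2 := lt_of_mem_ladder_preds hu
        rw [← Option.some.inj hv] at h2
        exact Or.inl h2
      · convert this using 1
        simp only [Move.apply, Config.mk.injEq, and_true]
        funext p
        ext ⟨b, j⟩
        simp only [Set.mem_union, Set.mem_ofPred_eq, Option.some.injEq, Prod.ext_iff, Fin.ext_iff]
        cases b <;> simp <;> omega
  have h0 := key n 0 (by omega)
  refine opt_le (k := 2) ?_
  convert h0 using 1
  simp only [Config.init, Config.mk.injEq, and_true]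
  funext p
  ext v
  simp

theorem ncard_union_some_le {V : Type} [Finite V] (A : Set V) (o : Option V) :
    (A ∪ {v | o = some v}).ncard ≤ A.ncard + 1 := by
  simpa using ncard_inter_union_some_le Set.univ A o

namespace FinishableWithin

variable {k r g c : ℕ} {G : CompDAG}

/-- Each processor loads at most one node, computes and saves at most one node, and returns to the
red pebbles it had before. -/
theorem exchange {R : Fin k → Set G.V} {B : Set G.V} (f f' : Selection G.V k)
    (hf : ∃ p v, f p = some v) (hf' : ∃ p v, f' p = some v) (hB : ∀ p v, f p = some v → v ∈ B)
    (hpre : ∀ p v, f' p = some v → G.preds v ⊆ R p ∪ {w | f p = some w})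
    (hr : ∀ p, (R p).ncard + 2 ≤ r)
    (h : FinishableWithin G r g ⟨R, B ∪ {v | ∃ p, f' p = some v}⟩ c) :
    FinishableWithin G r g ⟨R, B⟩ (c + (2 * g + 1)) := by
  have := G.finite
  -- Of the two free slots, one takes the loaded node and the other the computed one.
  have h1 : ∀ p, (R p ∪ {w | f p = some w}).ncard + 1 ≤ r := fun p =>
    (Nat.succ_le_succ (ncard_union_some_le (R p) (f p))).trans (hr p)
  refine (step (c := c + (g + 1)) (Move.load f) ⟨hf, hB⟩
    (fun p => (Nat.le_succ _).trans (h1 p)) ?_).mono (by simp only [Move.cost]; omega)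
  exact computeSave f' hf' hpre (fun p => Set.subset_union_left)
    (fun p => (ncard_union_some_le _ _).trans (h1 p)) h

/-- Loading the in-neighbours of a node, computing and saving the node. -/
theorem saveNode {B : Set G.V} {v : G.V} (hpre : G.preds v ⊆ B) (hr : (G.preds v).ncard + 1 ≤ r)
    (h : FinishableWithin G r g (⟨fun _ => ∅, B ∪ {v}⟩ : Config G.V 2) c) :
    FinishableWithin G r g (⟨fun _ => ∅, B⟩ : Config G.V 2) (c + (g + 1) + g * r) := by
  have := G.finite
  let f : Selection G.V 2 := fun q => if q = 0 then some v else none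
  let R : Fin 2 → Set G.V := fun q => if q = 0 then G.preds v else ∅
  have hf : ∀ q w, f q = some w ↔ q = 0 ∧ v = w := by
    intro q w
    by_cases hq : q = 0
    · simp [f, hq]
    · simp [f, hq]
  have hR : ∀ q, R q ⊆ G.preds v := by
    intro q
    by_cases hq : q = 0 <;> simp [R, hq]
  have hRr : ∀ q, (R q).ncard + 1 ≤ r := fun q =>
    (Nat.succ_le_succ (Set.ncard_le_ncard (hR q) (Set.toFinite _))).trans hr
  have hfset : {w | ∃ p, f p = some w} = {v} := by
    ext w
    simp [hf, eq_comm]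
  rw [← hfset] at h
  refine (loadAll (c := c + (g + 1)) (R' := R) (fun _ => Set.empty_subset _)
    (fun q w hw => Or.inr (hpre (hR q hw))) (fun q => (Nat.le_succ _).trans (hRr q))
    (computeSave f ⟨0, v, rfl⟩ ?_ (fun _ => Set.empty_subset _)
      (fun q => (ncard_union_some_le _ _).trans (hRr q)) h)).mono ?_
  · intro q w hw
    obtain ⟨rfl, rfl⟩ := (hf q w).1 hw
    exact subset_rfl
  · have : (G.preds v).ncard ≤ r := by omega
    simpa [Fin.sum_univ_two, R] using Nat.mul_le_mul_left g this

/-- Computing and saving all nodes of a ladder with index below `j`. -/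
theorem savePrefix (hr : ∀ v, ((ladder n D).preds v).ncard + 1 ≤ r) {j : ℕ} (hj : j ≤ n)
    (h : FinishableWithin (ladder n D) r g
      (⟨fun _ => ∅, {v | v.2.val < j}⟩ : Config (Bool × Fin n) 2) c) :
    FinishableWithin (ladder n D) r g (Config.init (Bool × Fin n) 2)
      (c + j * (2 * (g + 1 + g * r))) := by
  induction j generalizing c with
  | zero =>
    have : {v : Bool × Fin n | v.2.val < 0} = ∅ := by ext v; simp
    rw [this] at h
    simpa [Config.init] using h
  | succ j ih =>
    have hset : {v : Bool × Fin n | v.2.val < j + 1} =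
        {v | v.2.val < j} ∪ {(false, ⟨j, hj⟩)} ∪ {(true, ⟨j, hj⟩)} := by
      ext ⟨b, i⟩
      simp only [Set.mem_union, Set.mem_ofPred_eq, Set.mem_singleton_iff, Prod.ext_iff, Fin.ext_iff]
      cases b <;> simp <;> omega
    rw [hset] at h
    have hpre : ∀ b, (ladder n D).preds ((b, ⟨j, hj⟩) : Bool × Fin n) ⊆ {v | v.2.val < j} :=
      fun b u hu => lt_of_mem_ladder_preds hu
    refine (ih (by omega) (saveNode (hpre false) (hr _)
      (saveNode ((hpre true).trans Set.subset_union_left) (hr _) h))).mono ?_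
    rw [add_one_mul]
    omega

end FinishableWithin

/-! ### The optimum for alternating blocks -/

/-- The block of the `false` path that the processor `q` keeps in its memory. -/
def block (n m : ℕ) (q : Fin 2) : Set (Bool × Fin n) :=
  {u | u.1 = false ∧ u.2.val ∈ Finset.Ico (m * q) (m * q + m)}

theorem ncard_block {m : ℕ} (hn : 2 * m ≤ n) (q : Fin 2) : (block n m q).ncard = m := by
  rw [block, ncard_row]
  · simp
  · intro i h
    have := block_lt q.2 (Finset.mem_Ico.1 h).2
    omega

theorem rung_subset_block {m j : ℕ} {q : Fin 2} (hq : q.val = j % 2) :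
    rung n (alternatingBlocks m) j ⊆ block n m q := by
  rintro u ⟨h1, -, h2⟩
  refine ⟨h1, ?_⟩
  rw [hq]
  exact Finset.mem_Ico.2 (mem_alternatingBlocks.1 h2).2

theorem ncard_preds_alternatingBlocks_le {m : ℕ} (hn : 2 * m ≤ n) (v : Bool × Fin n) :
    ((ladder n (alternatingBlocks m)).preds v).ncard ≤ m + 1 := by
  obtain ⟨b, ⟨i, hi⟩⟩ := v
  cases i with
  | zero => simp [ladder_preds_zero]
  | succ i =>
    rw [ladder_preds_succ]
    exact (Set.ncard_insert_le _ _).trans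
      (Nat.succ_le_succ (ncard_rung_alternatingBlocks_le _ _ hn))

theorem maxInDegree_alternatingBlocks {m : ℕ} (hn : 2 * m + 1 < n) :
    (ladder n (alternatingBlocks m)).maxInDegree = m + 1 := by
  have hle : ∀ v, (ladder n (alternatingBlocks m)).inDegree v ≤ m + 1 :=
    ncard_preds_alternatingBlocks_le (by omega)
  have : Nonempty (ladder n (alternatingBlocks m)).V := ⟨(true, ⟨2 * m + 1, hn⟩)⟩
  refine le_antisymm (ciSup_le hle) ?_
  refine le_ciSup_of_le ⟨m + 1, by rintro _ ⟨v, rfl⟩; exact hle v⟩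
    ((true, ⟨2 * m + 1, hn⟩) : Bool × Fin n) (le_of_eq ?_)
  change _ = ((ladder n (alternatingBlocks m)).preds _).ncard
  rw [ladder_preds_succ, Set.ncard_insert_of_notMem (not_mem_rung_succ _ _) (Set.toFinite _),
    ncard_rung_alternatingBlocks (by omega) (by omega)]

/-- With one block in each memory, and the `true` path one step ahead, each step of both paths needs
only one load and one save. -/
theorem finishableWithin_alternatingBlocks {m g : ℕ} (d : ℕ) :
    ∀ i (hi : i + d + 1 = n) (B : Set (Bool × Fin n)), 2 * m < i →
      (true, ⟨i, by omega⟩) ∈ B → (false, ⟨i - 1, by omega⟩) ∈ B →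
      FinishableWithin (ladder n (alternatingBlocks m)) (m + 2) g
        (⟨block n m, B⟩ : Config (Bool × Fin n) 2) ((d + 1) * (2 * g + 1)) := by
  have hcard : 2 * m ≤ n → ∀ p, (block n m p).ncard + 2 ≤ m + 2 := fun h p => by
    rw [ncard_block h]
  have hpreds : ∀ (b : Bool) (i j : ℕ) (hi : i < n) (hj : j < n) (q : Fin 2), i = j + 1 →
      q.val = i % 2 → (ladder n (alternatingBlocks m)).preds ((b, ⟨i, hi⟩) : Bool × Fin n) ⊆
        block n m q ∪ {(b, ⟨j, hj⟩)} := by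
    rintro b _ j hi hj q rfl hq
    rw [ladder_preds_succ, Set.insert_eq, Set.union_comm]
    exact Set.union_subset_union_left _ (rung_subset_block hq)
  induction d with
  | zero =>
    intro i hi B hm hB1 hB2
    -- At the last index the `true` path is already complete, so only the processor holding the
    -- block for this parity acts.
    let q : Fin 2 := ⟨i % 2, Nat.mod_lt _ two_pos⟩
    refine (exchange (c := 0)
      (fun p => if p = q then some (false, ⟨i - 1, by omega⟩) else none)
      (fun p => if p = q then some (false, ⟨i, by omega⟩) else none)
      ⟨q, _, if_pos rfl⟩ ⟨q, _, if_pos rfl⟩ ?_ ?_ (hcard (by omega))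
      (of_terminal ?_)).mono (by omega)
    · intro p v hv
      split_ifs at hv
      rwa [← Option.some.inj hv]
    · intro p v hv
      split_ifs at hv with hp
      rw [← Option.some.inj hv]
      subst hp
      refine (hpreds _ i (i - 1) (by omega) (by omega) q (by omega) rfl).trans
        (Set.union_subset_union_right _ ?_)
      rintro w rfl
      exact if_pos rfl
    · rintro ⟨b, j⟩ hsink
      left
      have hj : j.val = i := by
        by_contra hne
        exact hsink ((b, ⟨j + 1, by omega⟩) : Bool × Fin n) (Or.inl ⟨rfl, rfl⟩)
      rw [show j = ⟨i, by omega⟩ from Fin.ext hj]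
      cases b with
      | true => exact Or.inl hB1
      | false => exact Or.inr ⟨q, if_pos rfl⟩
  | succ d ih =>
    intro i hi B hm hB1 hB2
    let q : Fin 2 := ⟨i % 2, Nat.mod_lt _ two_pos⟩
    let q' : Fin 2 := ⟨(i + 1) % 2, Nat.mod_lt _ two_pos⟩
    have hqq : ∀ p, p ≠ q → p = q' := by
      intro p hp
      have h1 : p.val ≠ i % 2 := fun h => hp (Fin.ext h)
      exact Fin.ext (by change p.val = (i + 1) % 2; omega)
    have hq' : q' ≠ q := by
      intro h
      have : (i + 1) % 2 = i % 2 := congrArg Fin.val h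
      omega
    rw [add_one_mul (d + 1)]
    -- The lead of the `true` path gives the two nodes computed together opposite parities, so they
    -- use different blocks and each processor has the right one. The paths thus swap processors at
    -- every stage.
    refine exchange
      (fun p => if p = q then some (false, ⟨i - 1, by omega⟩) else some (true, ⟨i, by omega⟩))
      (fun p => if p = q then some (false, ⟨i, by omega⟩) else some (true, ⟨i + 1, by omega⟩))
      ⟨q, _, if_pos rfl⟩ ⟨q, _, if_pos rfl⟩ ?_ ?_ (hcard (by omega))
      (ih (i + 1) (by omega) _ (by omega) ?_ ?_)
    · intro p v hv
      split_ifs at hv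
      · rwa [← Option.some.inj hv]
      · rwa [← Option.some.inj hv]
    · intro p v hv
      split_ifs at hv with hp
      · rw [← Option.some.inj hv]
        subst hp
        refine (hpreds _ i (i - 1) (by omega) (by omega) q (by omega) rfl).trans
          (Set.union_subset_union_right _ ?_)
        rintro w rfl
        exact if_pos rfl
      · rw [← Option.some.inj hv]
        obtain rfl := hqq p hp
        refine (hpreds _ (i + 1) i (by omega) (by omega) q' rfl rfl).trans
          (Set.union_subset_union_right _ ?_)
        rintro w rfl
        exact if_neg hq'
    · exact Or.inr ⟨q', if_neg hq'⟩
    · exact Or.inr ⟨q, if_pos rfl⟩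

/-- The start-up saves the nodes of index below `2 * m + 2` and loads both blocks. Its cost is
bounded crudely, which is harmless because it does not depend on `n`. -/
theorem opt_alternatingBlocks_le {m g : ℕ} (hn : 2 * m + 1 < n) :
    pebblingOPT (ladder n (alternatingBlocks m)) 2 (m + 2) g ≤
      n * (2 * g + 1) + (g * (2 * m) + (2 * m + 2) * (2 * (g + 1 + g * (m + 2)))) := by
  obtain ⟨d, rfl⟩ : ∃ d, n = 2 * m + 1 + d + 1 := ⟨n - (2 * m + 2), by omega⟩
  -- The prefix ends after index `2 * m + 1`, since the `true` node of that index must be blue to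
  -- give the `true` path its lead.
  have h1 := finishableWithin_alternatingBlocks (m := m) (g := g) d (2 * m + 1) rfl
    {v | v.2.val < 2 * m + 2} (by omega) (by simp) (by simp)
  have hval : (⟨block _ m, {v | v.2.val < 2 * m + 2}⟩ :
      Config (Bool × Fin (2 * m + 1 + d + 1)) 2).Valid (m + 2) := fun p => by
    change (block _ m p).ncard ≤ m + 2
    rw [ncard_block (by omega)]
    omega
  have h2 := loadAll (R := fun _ => ∅) (fun _ => Set.empty_subset _) (fun p u hu => Or.inr (by
    have := block_lt p.2 (Finset.mem_Ico.1 hu.2).2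
    exact (show u.2.val < 2 * m + 2 by omega))) hval h1
  have h3 := savePrefix (r := m + 2) (fun v => Nat.succ_le_succ
    (ncard_preds_alternatingBlocks_le (by omega) v)) (by omega) h2
  refine (opt_le h3).trans ?_
  have h4 : ∑ p, (block (2 * m + 1 + d + 1) m p \ ∅).ncard = 2 * m := by
    simp [ncard_block (show 2 * m ≤ 2 * m + 1 + d + 1 by omega), two_mul]
  rw [h4]
  have h5 : (d + 1) * (2 * g + 1) ≤ (2 * m + 1 + d + 1) * (2 * g + 1) :=
    Nat.mul_le_mul_right _ (by omega)
  omega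

/-! ### The main theorem -/

/-- An asymptotic comparison of a linear lower bound with a linear upper bound. -/
theorem GreedyWorseByFactor.of_linear {k g : ℕ} {r : ℕ → ℕ} {G : ℕ → CompDAG} {c α β K L : ℝ}
    (hc : c * α < β)
    (hopt : ∀ i, (pebblingOPT (G i) k (r i) g : ℝ) ≤ α * i + K)
    (hcost : ∀ rule i P, IsGreedyPebbling rule (G i) k (r i) P →
      β * i - L ≤ (pebblingCost g P : ℝ)) :
    GreedyWorseByFactor k g r G c := by
  intro rule ε hε
  filter_upwards [eventually_ge_atTop ⌈(c * K + L) / (β - c * α)⌉₊] with i hi P hP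
  -- A nonpositive factor makes the claim trivial; otherwise `c > 0`, and the bound on the optimum
  -- may be multiplied by `c`.
  rcases le_or_gt (c - ε) 0 with h | h
  · exact (mul_nonpos_of_nonpos_of_nonneg h (Nat.cast_nonneg _)).trans (Nat.cast_nonneg _)
  · have h1 : (c * K + L) / (β - c * α) ≤ i := Nat.ceil_le.1 hi
    rw [div_le_iff₀ (by linarith)] at h1
    have h2 : (c - ε) * (pebblingOPT (G i) k (r i) g : ℝ) ≤
        c * (pebblingOPT (G i) k (r i) g : ℝ) :=
      mul_le_mul_of_nonneg_right (by linarith) (Nat.cast_nonneg _)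
    have h3 := mul_le_mul_of_nonneg_left (hopt i) (show 0 ≤ c by linarith)
    have h4 := hcost rule i P hP
    nlinarith

/-- The graph with `n` nodes and no edges. -/
def edgelessDAG (n : ℕ) : CompDAG where
  V := Fin n
  finite := inferInstance
  graph := ⟨fun _ _ => False⟩
  acyclic := by
    intro v h
    cases h with
    | single h => exact h
    | tail _ h => exact h

theorem edgelessDAG_maxInDegree (n : ℕ) : (edgelessDAG n).maxInDegree = 0 := by
  have : ∀ v, (edgelessDAG n).inDegree v = 0 := fun v => Set.ncard_empty _
  exact Nat.le_zero.1 (ciSup_le' fun v => (this v).le)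

/-- For `Δ = 0` the factor is negative. For `Δ = m + 1` the ratio of the slopes is `(g * m + 1) / (2
* g + 1) ≥ m / 3`, which exceeds `Δ / 5 - 1`. -/
theorem exists_greedy_worse_small_memory (Δ g : ℕ) (hg : 1 ≤ g) :
    ∃ (G : ℕ → CompDAG) (r : ℕ),
      Tendsto (fun i => (G i).size) atTop atTop ∧ (∀ i, (G i).maxInDegree = Δ) ∧ Δ + 1 ≤ r ∧
      GreedyWorseByFactor 2 g (fun _ => r) G ((Δ : ℝ) / 5 - 1) := by
  cases Δ with
  | zero =>
    refine ⟨edgelessDAG, 1, ?_, edgelessDAG_maxInDegree, le_rfl, ?_⟩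
    · have : ∀ i, (edgelessDAG i).size = i := fun i => Nat.card_fin i
      exact tendsto_atTop_mono (fun i => (this i).ge) tendsto_id
    · intro rule ε hε
      refine Eventually.of_forall fun i P _ => ?_
      refine (mul_nonpos_of_nonpos_of_nonneg ?_ (Nat.cast_nonneg _)).trans (Nat.cast_nonneg _)
      norm_num
      linarith
  | succ m =>
    refine ⟨fun i => ladder (i + (2 * m + 2)) (alternatingBlocks m), m + 2, ?_,
      fun i => maxInDegree_alternatingBlocks (by omega), le_rfl, ?_⟩
    · refine tendsto_atTop_mono (fun i => ?_) tendsto_id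
      rw [ladder_size, id]
      omega
    · have hg' : (1 : ℝ) ≤ g := by exact_mod_cast hg
      have hmg : (0 : ℝ) ≤ m * (g - 1) := mul_nonneg (Nat.cast_nonneg _) (by linarith)
      refine GreedyWorseByFactor.of_linear (α := 2 * g + 1) (β := g * m + 1)
        (K := (2 * m + 2) * (2 * g + 1) +
          (g * (2 * m) + (2 * m + 2) * (2 * (g + 1 + g * (m + 2)))))
        (L := 2 * (g * m + 1) * (2 * m + 1)) ?_ (fun i => ?_) fun rule i P hP => ?_
      · push_cast
        nlinarith
      · have := opt_alternatingBlocks_le (n := i + (2 * m + 2)) (m := m) (g := g) (by omega)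
        have h' : (pebblingOPT (ladder (i + (2 * m + 2)) (alternatingBlocks m)) 2 (m + 2) g : ℝ) ≤
          (i + (2 * m + 2)) * (2 * g + 1) +
            (g * (2 * m) + (2 * m + 2) * (2 * (g + 1 + g * (m + 2)))) := by exact_mod_cast this
        linarith
      · have := greedy_cost_alternatingBlocks (g := g) (by omega) hP
        have h' : ((i : ℝ) + (2 * m + 2)) * (g * m + 1) ≤
          2 * (g * m + 1) * (2 * m + 1) + pebblingCost g P := by exact_mod_cast this
        have : (0 : ℝ) ≤ (2 * m + 2) * (g * m + 1) := by positivity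
        linarith

/-- The slopes `2 * g + 1` and `2` have ratio `g + 1 / 2`, which exceeds `2 * g / 3 + 1` exactly
when `g > 3 / 2`. -/
theorem exists_greedy_worse_unbounded_memory (g : ℕ) (hg : 2 ≤ g) :
    ∃ G : ℕ → CompDAG, Tendsto (fun i => (G i).size) atTop atTop ∧
      ∀ r : ℕ → ℕ, (∀ i, (G i).size ≤ r i) →
        GreedyWorseByFactor 2 g r G (2 * (g : ℝ) / 3 + 1) := by
  refine ⟨fun i => ladder (i + 2) fun j => {j - 2}, ?_, fun r hr => ?_⟩
  · refine tendsto_atTop_mono (fun i => ?_) tendsto_id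
    rw [ladder_size, id]
    omega
  · have hg' : (2 : ℝ) ≤ g := by exact_mod_cast hg
    refine GreedyWorseByFactor.of_linear (α := 2) (β := 2 * g + 1) (K := 4) (L := 0)
      (by linarith) (fun i => ?_) fun rule i P hP => ?_
    · have := opt_ladder_le (g := g) (hr i)
      have h' : (pebblingOPT (ladder (i + 2) fun j => {j - 2}) 2 (r i) g : ℝ) ≤ 2 * (i + 2) := by
        exact_mod_cast this
      linarith
    · have := greedy_cost_shift (g := g) (by omega) hP
      rw [Nat.add_sub_cancel] at this
      have h' : ((i : ℝ) + 2) + 2 * g * i ≤ pebblingCost g P := by exact_mod_cast this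
      linarith

theorem mainTheorem5 :
    (∀ Δ g : ℕ, 1 ≤ g →
      ∃ (G : ℕ → CompDAG) (r : ℕ),
        Tendsto (fun i => (G i).size) atTop atTop ∧
        (∀ i, (G i).maxInDegree = Δ) ∧
        Δ + 1 ≤ r ∧
        GreedyWorseByFactor 2 g (fun _ => r) G ((Δ : ℝ) / 5 - 1)) ∧
    (∀ g : ℕ, 2 ≤ g →
      ∃ G : ℕ → CompDAG,
        Tendsto (fun i => (G i).size) atTop atTop ∧
        ∀ r : ℕ → ℕ, (∀ i, (G i).size ≤ r i) →
          GreedyWorseByFactor 2 g r G (2 * (g : ℝ) / 3 + 1)) := by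
  exact ⟨exists_greedy_worse_small_memory, exists_greedy_worse_unbounded_memory⟩
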